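/- Let $N_a,N_b\ge 2$ and $\mathcal H=\mathbb C^{N_a}\otimes\mathbb C^{N_b}$. A (normalized) witness is a Hermitian matrix $\Omega$ on $\mathcal H$ with $\operatorname{Tr}\Omega=1$ and $f_\Omega(\phi,\chi)=(\phi\otimes\chi)^\dagger\Omega(\phi\otimes\chi)\ge 0$ for all $\phi\in\mathbb C^{N_a}$, $\chi\in\mathbb C^{N_b}$. A zero of $\Omega$ is a pair $(\phi_0,\chi_0)$ of nonzero vectors with $f_\Omega(\phi_0,\chi_0)=0$; it is a quadratic zero if the quadratic term in $(\xi,\zeta)$ of $f_\Omega(\phi_0+\xi,\chi_0+\zeta)$, $$(\xi\otimes\chi_0)^\dagger\Omega(\xi\otimes\chi_0)+(\phi_0\otimes\zeta)^\dagger\Omega(\phi_0\otimes\zeta)+2\operatorname{Re}\big((\phi_0\otimes\zeta)^\dagger\Omega(\xi\otimes\chi_0)+(\phi_0\otimes\chi_0)^\dagger\Omega(\xi\otimes\zeta)\big),$$ is strictly positive for all $(\xi,\zeta)\ne(0,0)$ with $\phi_0^\dagger\xi=0$ and $\chi_0^\dagger\zeta=0$. A quadratic witness is a witness on the boundary of the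 convex set of normalized witnesses (relative to its affine hull; equivalently, a witness with at least one zero), all of whose zeros are quadratic. The partial transpose of $A$ is $(A^{\mathsf P})_{ij;kl}=A_{il;kj}$, and a matrix is decomposable if it equals $\rho+\sigma^{\mathsf P}$ with $\rho,\sigma$ positive semidefinite. A witness $\Omega$ is optimal (respectively, nondecomposable optimal) if there are no normalized witnesses $\Omega_0,\Omega_1$, both different from $\Omega$, and no $0<p<1$ with $\Omega=(1-p)\Omega_0+p\,\Omega_1$ such that $\Omega_1$ is positive semidefinite (respectively, decomposable). Let $\Omega$ be a quadratic witness. Then: 1. $\Omega$ is optimal if and only if the vectors $\phi\otimes\chi$, with $(\phi,\chi)$ ranging over the zeros of $\Omega$, span $\mathcal H$. 2. $\Omega$ is nondecomposable optimal if and only if the vectors $\phi\otimes\chi$ span $\mathcal H$ and also the vectors $\phi\otimes\chi^*$ span $\mathcal H$, with $(\phi,\chi)$ in both cases ranging over the zeros of $\Omega$ and $\chi^*$ the complex conjugate of $\chi$. 3. Hence, if $\Omega$ is nondecomposable optimal, then it is not decomposable. -/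

import Mathlib

open scoped ComplexOrder Matrix

namespace EntanglementWitness

/-- Matrices on the Hilbert space `ℂ^m ⊗ ℂ^n`, with rows and columns indexed by pairs. -/
abbrev BipartiteMatrix (m n : ℕ) : Type :=
  Matrix (Fin m × Fin n) (Fin m × Fin n) ℂ

/-- The product vector `φ ⊗ χ`. -/
def prodVec {m n : ℕ} (φ : Fin m → ℂ) (χ : Fin n → ℂ) : Fin m × Fin n → ℂ :=
  fun I => φ I.1 * χ I.2

/-- The sesquilinear expression `u† A v`. -/
def sesq {m n : ℕ} (A : BipartiteMatrix m n) (u v : Fin m × Fin n → ℂ) : ℂ :=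
  star u ⬝ᵥ (A *ᵥ v)

/-- The biquadratic form `f_A(φ, χ) = (φ ⊗ χ)† A (φ ⊗ χ)`; it is real for Hermitian `A`. -/
def biquadForm {m n : ℕ} (A : BipartiteMatrix m n) (φ : Fin m → ℂ) (χ : Fin n → ℂ) : ℝ :=
  (sesq A (prodVec φ χ) (prodVec φ χ)).re

/-- The partial transpose with respect to the second factor,
`(A^P)_{ij;kl} = A_{il;kj}`. -/
def partialTranspose {m n : ℕ} (A : BipartiteMatrix m n) : BipartiteMatrix m n :=
  Matrix.of fun I J => A (I.1, J.2) (J.1, I.2)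

/-- The set of normalized witnesses: Hermitian matrices of unit trace
whose biquadratic form is nonnegative. -/
def witnesses (m n : ℕ) : Set (BipartiteMatrix m n) :=
  {A | A.IsHermitian ∧ A.trace = 1 ∧ ∀ φ χ, 0 ≤ biquadForm A φ χ}

/-- The pair `(φ, χ)` of nonzero vectors is a zero of `A`. -/
def IsZero {m n : ℕ} (A : BipartiteMatrix m n) (φ : Fin m → ℂ) (χ : Fin n → ℂ) : Prop :=
  φ ≠ 0 ∧ χ ≠ 0 ∧ biquadForm A φ χ = 0

/-- The part of `f_A(φ + ξ, χ + ζ)` that is homogeneous of degree two in `(ξ, ζ)`, for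
Hermitian `A`: half of the Hessian of the form at `(φ, χ)`, evaluated at `(ξ, ζ)`. -/
def hessianForm {m n : ℕ} (A : BipartiteMatrix m n) (φ : Fin m → ℂ) (χ : Fin n → ℂ)
    (ξ : Fin m → ℂ) (ζ : Fin n → ℂ) : ℝ :=
  (sesq A (prodVec ξ χ) (prodVec ξ χ)).re + (sesq A (prodVec φ ζ) (prodVec φ ζ)).re
    + 2 * (sesq A (prodVec φ ζ) (prodVec ξ χ) + sesq A (prodVec φ χ) (prodVec ξ ζ)).re

/-- A zero at which the Hessian is strictly positive on the directions `(ξ, ζ) ≠ 0`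
with `ξ ⊥ φ` and `ζ ⊥ χ`. -/
def IsQuadraticZero {m n : ℕ} (A : BipartiteMatrix m n) (φ : Fin m → ℂ) (χ : Fin n → ℂ) :
    Prop :=
  IsZero A φ χ ∧ ∀ (ξ : Fin m → ℂ) (ζ : Fin n → ℂ),
    star φ ⬝ᵥ ξ = 0 → star χ ⬝ᵥ ζ = 0 → (ξ ≠ 0 ∨ ζ ≠ 0) → 0 < hessianForm A φ χ ξ ζ

/-- A quadratic witness: a witness on the (relative) boundary of the convex set of normalized
witnesses, all of whose zeros are quadratic. -/
def IsQuadraticWitness {m n : ℕ} (A : BipartiteMatrix m n) : Prop :=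
  A ∈ witnesses m n ∧ A ∈ intrinsicFrontier ℝ (witnesses m n) ∧
    ∀ φ χ, IsZero A φ χ → IsQuadraticZero A φ χ

/-- `A = ρ + σ^P` with `ρ` and `σ` positive semidefinite. -/
def IsDecomposable {m n : ℕ} (A : BipartiteMatrix m n) : Prop :=
  ∃ ρ σ : BipartiteMatrix m n, ρ.PosSemidef ∧ σ.PosSemidef ∧ A = ρ + partialTranspose σ

/-- `A` is a proper convex combination `(1 - p) A₀ + p A₁` of two other normalized witnesses,
where `A₁` belongs to the class `C`. -/
def IsProperMixtureWith {m n : ℕ} (C : BipartiteMatrix m n → Prop) (A : BipartiteMatrix m n) :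
    Prop :=
  ∃ A₀ ∈ witnesses m n, ∃ A₁ ∈ witnesses m n, A₀ ≠ A ∧ A₁ ≠ A ∧ C A₁ ∧
    ∃ p : ℝ, 0 < p ∧ p < 1 ∧ A = (1 - p) • A₀ + p • A₁

/-- An optimal witness: not a proper convex combination of two other witnesses one of which
is positive semidefinite. -/
def IsOptimal {m n : ℕ} (A : BipartiteMatrix m n) : Prop :=
  A ∈ witnesses m n ∧ ¬ IsProperMixtureWith (fun B => B.PosSemidef) A

/-- A nondecomposable optimal witness: not a proper convex combination of two other witnesses
one of which is decomposable. -/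
def IsNondecomposableOptimal {m n : ℕ} (A : BipartiteMatrix m n) : Prop :=
  A ∈ witnesses m n ∧ ¬ IsProperMixtureWith IsDecomposable A

/-- The complex span of the product vectors `φ ⊗ χ` over all zeros `(φ, χ)` of `A`. -/
def zeroSpan {m n : ℕ} (A : BipartiteMatrix m n) : Submodule ℂ (Fin m × Fin n → ℂ) :=
  Submodule.span ℂ {ψ | ∃ φ χ, IsZero A φ χ ∧ ψ = prodVec φ χ}

/-- The complex span of the product vectors `φ ⊗ χ*` over all zeros `(φ, χ)` of `A`. -/
def partialConjZeroSpan {m n : ℕ} (A : BipartiteMatrix m n) :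
    Submodule ℂ (Fin m × Fin n → ℂ) :=
  Submodule.span ℂ {ψ | ∃ φ χ, IsZero A φ χ ∧ ψ = prodVec φ (star χ)}

end EntanglementWitness

open Filter Topology

namespace EntanglementWitness

/-! ### Algebra and continuity of the biquadratic form -/

section Sesq

variable {m n : ℕ}

/-! Everything rests on one domination principle (`exists_biquadForm_domination`). If all zeros of
`A` are quadratic and a nonnegative form `f_B` vanishes at all of them, then `ε f_B ≤ f_A` for some
`ε > 0`. Near a zero both forms vanish to second order, and the Hessian of `f_A` is strictly
positive transversally to rescalings, so it absorbs that of `f_B`; away from the zeros `f_A` is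
positive; compactness makes `ε` uniform. Hence a multiple of any such witness `B ≠ A` can be
subtracted from `A` and the rest renormalized.

If the vectors `φ ⊗ χ` do not span, the projection onto a unit vector `ψ` orthogonal to them is such
a `B`, so `A` is not optimal. If the vectors `φ ⊗ χ*` do not span, the partial transpose of such a
projection serves. Neither matrix equals `A`, because in dimensions at least two they have zeros
with degenerate Hessian.

Conversely, in a mixture the component `A₁` must vanish at every zero of `A`. A positive
semidefinite matrix annihilates the product vectors at which its form vanishes; with the spanning
conditions this forces `A₁ = 0`, contradicting unit trace. Applied to `A` itself, the same argument
gives the third claim. -/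

lemma sesq_add_left (A : BipartiteMatrix m n) (u u' v : Fin m × Fin n → ℂ) :
    sesq A (u + u') v = sesq A u v + sesq A u' v := by
  simp [sesq, add_dotProduct]

lemma sesq_add_right (A : BipartiteMatrix m n) (u v v' : Fin m × Fin n → ℂ) :
    sesq A u (v + v') = sesq A u v + sesq A u v' := by
  simp [sesq, Matrix.mulVec_add, dotProduct_add]

lemma sesq_smul_left (A : BipartiteMatrix m n) (c : ℂ) (u v : Fin m × Fin n → ℂ) :
    sesq A (c • u) v = star c * sesq A u v := by
  simp [sesq, smul_dotProduct]

lemma sesq_smul_right (A : BipartiteMatrix m n) (c : ℂ) (u v : Fin m × Fin n → ℂ) :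
    sesq A u (c • v) = c * sesq A u v := by
  simp [sesq, Matrix.mulVec_smul, dotProduct_smul]

lemma sesq_add_matrix (A B : BipartiteMatrix m n) (u v : Fin m × Fin n → ℂ) :
    sesq (A + B) u v = sesq A u v + sesq B u v := by
  simp [sesq, Matrix.add_mulVec, dotProduct_add]

lemma sesq_real_smul_matrix (c : ℝ) (A : BipartiteMatrix m n) (u v : Fin m × Fin n → ℂ) :
    sesq (c • A) u v = c * sesq A u v := by
  simp [sesq, Matrix.smul_mulVec, dotProduct_smul]

lemma star_sesq {A : BipartiteMatrix m n} (hA : A.IsHermitian) (u v : Fin m × Fin n → ℂ) :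
    star (sesq A u v) = sesq A v u := by
  rw [sesq, sesq, ← Matrix.star_dotProduct, Matrix.star_mulVec, hA.eq, ← Matrix.dotProduct_mulVec]

lemma re_sesq_comm {A : BipartiteMatrix m n} (hA : A.IsHermitian) (u v : Fin m × Fin n → ℂ) :
    (sesq A u v).re = (sesq A v u).re := by
  rw [← star_sesq hA v u]; simp

lemma biquadForm_add (A B : BipartiteMatrix m n) (φ : Fin m → ℂ) (χ : Fin n → ℂ) :
    biquadForm (A + B) φ χ = biquadForm A φ χ + biquadForm B φ χ := by
  simp [biquadForm, sesq_add_matrix]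

lemma biquadForm_real_smul (c : ℝ) (A : BipartiteMatrix m n) (φ : Fin m → ℂ) (χ : Fin n → ℂ) :
    biquadForm (c • A) φ χ = c * biquadForm A φ χ := by
  simp [biquadForm, sesq_real_smul_matrix]

lemma prodVec_add_left (φ ξ : Fin m → ℂ) (χ : Fin n → ℂ) :
    prodVec (φ + ξ) χ = prodVec φ χ + prodVec ξ χ := by
  ext I; simp [prodVec, add_mul]

lemma prodVec_add_right (φ : Fin m → ℂ) (χ ζ : Fin n → ℂ) :
    prodVec φ (χ + ζ) = prodVec φ χ + prodVec φ ζ := by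
  ext I; simp [prodVec, mul_add]

lemma prodVec_smul_left (a : ℂ) (φ : Fin m → ℂ) (χ : Fin n → ℂ) :
    prodVec (a • φ) χ = a • prodVec φ χ := by
  ext I; simp [prodVec, mul_assoc]

lemma prodVec_smul_right (b : ℂ) (φ : Fin m → ℂ) (χ : Fin n → ℂ) :
    prodVec φ (b • χ) = b • prodVec φ χ := by
  ext I; simp [prodVec, mul_left_comm]

@[simp] lemma prodVec_zero_left (χ : Fin n → ℂ) : prodVec (0 : Fin m → ℂ) χ = 0 := by
  ext I; simp [prodVec]

@[simp] lemma prodVec_zero_right (φ : Fin m → ℂ) : prodVec φ (0 : Fin n → ℂ) = 0 := by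
  ext I; simp [prodVec]

lemma biquadForm_smul_smul (A : BipartiteMatrix m n) (a b : ℂ) (φ : Fin m → ℂ)
    (χ : Fin n → ℂ) :
    biquadForm A (a • φ) (b • χ) = ‖a‖ ^ 2 * ‖b‖ ^ 2 * biquadForm A φ χ := by
  have ha : star a * a = ((‖a‖ ^ 2 : ℝ) : ℂ) := by
    simpa using Complex.conj_mul' a
  have hb : star b * b = ((‖b‖ ^ 2 : ℝ) : ℂ) := by
    simpa using Complex.conj_mul' b
  simp only [biquadForm, prodVec_smul_left, prodVec_smul_right, sesq_smul_left, sesq_smul_right]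
  rw [show b * (a * (star b * (star a * sesq A (prodVec φ χ) (prodVec φ χ)))) =
    (star a * a) * ((star b * b) * sesq A (prodVec φ χ) (prodVec φ χ)) by ring, ha, hb,
    Complex.re_ofReal_mul, Complex.re_ofReal_mul, mul_assoc]

lemma continuous_prodVec : Continuous fun x : (Fin m → ℂ) × (Fin n → ℂ) => prodVec x.1 x.2 := by
  unfold prodVec
  fun_prop

lemma continuous_sesq (A : BipartiteMatrix m n) :
    Continuous fun x : (Fin m × Fin n → ℂ) × (Fin m × Fin n → ℂ) => sesq A x.1 x.2 := by
  unfold sesq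
  exact continuous_fst.star.dotProduct (continuous_const.matrix_mulVec continuous_snd)

lemma continuous_biquadForm (A : BipartiteMatrix m n) :
    Continuous fun x : (Fin m → ℂ) × (Fin n → ℂ) => biquadForm A x.1 x.2 :=
  Complex.continuous_re.comp
    ((continuous_sesq A).comp (continuous_prodVec.prodMk continuous_prodVec))

end Sesq

/-! ### Expansion of the form along a line through a zero -/

section Taylor

variable {m n : ℕ}

/-- The coefficient of `t` in `f_A(φ + t ξ, χ + t ζ)`. -/
def linearTerm (A : BipartiteMatrix m n) (φ : Fin m → ℂ) (χ : Fin n → ℂ)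
    (ξ : Fin m → ℂ) (ζ : Fin n → ℂ) : ℝ :=
  (sesq A (prodVec φ χ) (prodVec ξ χ + prodVec φ ζ)
    + sesq A (prodVec ξ χ + prodVec φ ζ) (prodVec φ χ)).re

/-- The quotient by `t ^ 2` of the part of `f_A(φ + t ξ, χ + t ζ)` of order at least two. -/
def taylorQuotient (A : BipartiteMatrix m n) (φ : Fin m → ℂ) (χ : Fin n → ℂ)
    (t : ℝ) (ξ : Fin m → ℂ) (ζ : Fin n → ℂ) : ℝ :=
  (sesq A (prodVec ξ χ + prodVec φ ζ) (prodVec ξ χ + prodVec φ ζ)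
      + sesq A (prodVec φ χ) (prodVec ξ ζ) + sesq A (prodVec ξ ζ) (prodVec φ χ)).re
    + t * (sesq A (prodVec ξ χ + prodVec φ ζ) (prodVec ξ ζ)
      + sesq A (prodVec ξ ζ) (prodVec ξ χ + prodVec φ ζ)).re
    + t ^ 2 * (sesq A (prodVec ξ ζ) (prodVec ξ ζ)).re

lemma biquadForm_add_smul (A : BipartiteMatrix m n) (φ ξ : Fin m → ℂ) (χ ζ : Fin n → ℂ)
    (t : ℝ) :
    biquadForm A (φ + (t : ℂ) • ξ) (χ + (t : ℂ) • ζ) =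
      biquadForm A φ χ + t * linearTerm A φ χ ξ ζ + t ^ 2 * taylorQuotient A φ χ t ξ ζ := by
  simp only [biquadForm, linearTerm, taylorQuotient, prodVec_add_left, prodVec_add_right,
    prodVec_smul_left, prodVec_smul_right, sesq_add_left, sesq_add_right, sesq_smul_left,
    sesq_smul_right, Complex.star_def, Complex.conj_ofReal, Complex.add_re,
    Complex.re_ofReal_mul]
  ring

lemma taylorQuotient_zero {A : BipartiteMatrix m n} (hA : A.IsHermitian) (φ ξ : Fin m → ℂ)
    (χ ζ : Fin n → ℂ) : taylorQuotient A φ χ 0 ξ ζ = hessianForm A φ χ ξ ζ := by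
  simp only [taylorQuotient, hessianForm, sesq_add_left, sesq_add_right, Complex.add_re]
  rw [re_sesq_comm hA (prodVec ξ ζ) (prodVec φ χ), re_sesq_comm hA (prodVec ξ χ) (prodVec φ ζ)]
  ring

lemma continuous_taylorQuotient (A : BipartiteMatrix m n) (φ : Fin m → ℂ) (χ : Fin n → ℂ) :
    Continuous fun x : ℝ × (Fin m → ℂ) × (Fin n → ℂ) =>
      taylorQuotient A φ χ x.1 x.2.1 x.2.2 := by
  have h1 : Continuous fun x : ℝ × (Fin m → ℂ) × (Fin n → ℂ) =>
      prodVec x.2.1 χ + prodVec φ x.2.2 := by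
    unfold prodVec; fun_prop
  have h2 : Continuous fun x : ℝ × (Fin m → ℂ) × (Fin n → ℂ) => prodVec x.2.1 x.2.2 := by
    unfold prodVec; fun_prop
  have key : ∀ {u v : ℝ × (Fin m → ℂ) × (Fin n → ℂ) → Fin m × Fin n → ℂ},
      Continuous u → Continuous v → Continuous fun x => sesq A (u x) (v x) :=
    fun hu hv => (continuous_sesq A).comp (hu.prodMk hv)
  have h3 := key h1 h1
  have h4 := key (continuous_const (y := prodVec φ χ)) h2
  have h5 := key h2 (continuous_const (y := prodVec φ χ))
  have h6 := key h1 h2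
  have h7 := key h2 h1
  have h8 := key h2 h2
  unfold taylorQuotient
  fun_prop

/-- The factor `L + t * G t` has the sign of `t`, and its one-sided limits at `0` are both `L`. -/
lemma eq_zero_of_forall_mul_add_nonneg {L : ℝ} {G : ℝ → ℝ} (hG : Continuous G)
    (h : ∀ t, 0 ≤ t * (L + t * G t)) : L = 0 := by
  have ht : Tendsto (fun t : ℝ => L + t * G t) (𝓝 0) (𝓝 L) := by
    have hc : Continuous fun t : ℝ => L + t * G t := by fun_prop
    simpa using hc.tendsto 0
  apply le_antisymm
  · refine le_of_tendsto (ht.mono_left (nhdsWithin_le_nhds (s := Set.Iio 0))) ?_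
    filter_upwards [self_mem_nhdsWithin] with t ht0
    exact not_lt.1 fun hlt => (h t).not_gt (mul_neg_of_neg_of_pos ht0 hlt)
  · refine ge_of_tendsto (ht.mono_left (nhdsWithin_le_nhds (s := Set.Ioi 0))) ?_
    filter_upwards [self_mem_nhdsWithin] with t ht0
    exact not_lt.1 fun hlt => (h t).not_gt (mul_neg_of_pos_of_neg ht0 hlt)

lemma linearTerm_eq_zero {A : BipartiteMatrix m n} (hA : ∀ φ χ, 0 ≤ biquadForm A φ χ)
    {φ : Fin m → ℂ} {χ : Fin n → ℂ} (h0 : biquadForm A φ χ = 0) (ξ : Fin m → ℂ)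
    (ζ : Fin n → ℂ) : linearTerm A φ χ ξ ζ = 0 := by
  have hp : Continuous fun t : ℝ => (t, ξ, ζ) := by fun_prop
  have hG := (continuous_taylorQuotient A φ χ).comp hp
  simp only [Function.comp_def] at hG
  refine eq_zero_of_forall_mul_add_nonneg hG fun t => ?_
  have h := hA (φ + (t : ℂ) • ξ) (χ + (t : ℂ) • ζ)
  rwa [biquadForm_add_smul, h0, zero_add, pow_two, mul_assoc, ← mul_add] at h

lemma biquadForm_add_smul_of_zero {A : BipartiteMatrix m n}
    (hA : ∀ φ χ, 0 ≤ biquadForm A φ χ) {φ : Fin m → ℂ} {χ : Fin n → ℂ}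
    (h0 : biquadForm A φ χ = 0) (ξ : Fin m → ℂ) (ζ : Fin n → ℂ) (t : ℝ) :
    biquadForm A (φ + (t : ℂ) • ξ) (χ + (t : ℂ) • ζ) = t ^ 2 * taylorQuotient A φ χ t ξ ζ := by
  rw [biquadForm_add_smul, h0, linearTerm_eq_zero hA h0]
  ring

end Taylor

/-! ### Domination near quadratic zeros, then globally -/

section Domination

variable {m n : ℕ}

/-- The directions of unit norm that are orthogonal to `(φ, χ)` in each factor. -/
def unitTransverse (φ : Fin m → ℂ) (χ : Fin n → ℂ) : Set ((Fin m → ℂ) × (Fin n → ℂ)) :=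
  Metric.sphere 0 1 ∩ {x | star φ ⬝ᵥ x.1 = 0 ∧ star χ ⬝ᵥ x.2 = 0}

lemma isCompact_unitTransverse (φ : Fin m → ℂ) (χ : Fin n → ℂ) :
    IsCompact (unitTransverse φ χ) := by
  refine (isCompact_sphere _ _).inter_right (IsClosed.inter ?_ ?_)
  · exact isClosed_eq (continuous_const.dotProduct continuous_fst) continuous_const
  · exact isClosed_eq (continuous_const.dotProduct continuous_snd) continuous_const

/-- At `t = 0` the quotient for `A` is the Hessian, positive on a compact set of directions.
Compactness yields a common `ε` and a common range of `t`. -/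
lemma eventually_taylorQuotient_le {A : BipartiteMatrix m n} (hA : A.IsHermitian)
    (B : BipartiteMatrix m n) {φ : Fin m → ℂ} {χ : Fin n → ℂ} (hq : IsQuadraticZero A φ χ) :
    ∃ ε > 0, ∀ᶠ t in 𝓝 (0 : ℝ), ∀ x ∈ unitTransverse φ χ,
      ε * |taylorQuotient B φ χ t x.1 x.2| ≤ taylorQuotient A φ χ t x.1 x.2 := by
  refine (isCompact_unitTransverse φ χ).induction_on
    (p := fun s => ∃ ε > 0, ∀ᶠ t in 𝓝 (0 : ℝ), ∀ x ∈ s,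
      ε * |taylorQuotient B φ χ t x.1 x.2| ≤ taylorQuotient A φ χ t x.1 x.2) ?_ ?_ ?_ ?_
  · exact ⟨1, one_pos, by simp⟩
  · rintro s s' hs ⟨ε, hε, h⟩
    exact ⟨ε, hε, h.mono fun t ht x hx => ht x (hs hx)⟩
  · rintro s s' ⟨ε, hε, h⟩ ⟨ε', hε', h'⟩
    refine ⟨min ε ε', lt_min hε hε', ?_⟩
    filter_upwards [h, h'] with t ht ht'
    rintro x (hx | hx)
    · exact (mul_le_mul_of_nonneg_right (min_le_left _ _) (abs_nonneg _)).trans (ht x hx)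
    · exact (mul_le_mul_of_nonneg_right (min_le_right _ _) (abs_nonneg _)).trans (ht' x hx)
  · rintro x ⟨hx1, hx2, hx3⟩
    have hpos : 0 < taylorQuotient A φ χ 0 x.1 x.2 := by
      rw [taylorQuotient_zero hA]
      refine hq.2 _ _ hx2 hx3 ?_
      by_contra! h
      have : x = 0 := Prod.ext h.1 h.2
      simp [this] at hx1
    obtain ⟨ε, hε, hlt⟩ : ∃ ε > 0, ε * |taylorQuotient B φ χ 0 x.1 x.2|
        < taylorQuotient A φ χ 0 x.1 x.2 := by
      refine ⟨taylorQuotient A φ χ 0 x.1 x.2 / (|taylorQuotient B φ χ 0 x.1 x.2| + 1),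
        by positivity, ?_⟩
      rw [div_mul_eq_mul_div, div_lt_iff₀ (by positivity)]
      nlinarith
    have hev := ((((continuous_taylorQuotient B φ χ).abs.const_mul ε).tendsto (0, x)).eventually_lt
      ((continuous_taylorQuotient A φ χ).tendsto (0, x)) hlt)
    rw [nhds_prod_eq] at hev
    obtain ⟨pt, hpt, px, hpx, H⟩ := eventually_prod_iff.1 hev
    exact ⟨{y | px y}, mem_nhdsWithin_of_mem_nhds hpx, ε, hε,
      hpt.mono fun t ht y hy => (H ht hy).le⟩

/-- Both forms scale alike in each factor, so a nearby pair may be rescaled until its displacement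
from `(φ, χ)` is transverse; the second-order comparison then applies. -/
lemma biquadForm_domination_near_zero {A B : BipartiteMatrix m n} (hA : A.IsHermitian)
    (hA0 : ∀ φ χ, 0 ≤ biquadForm A φ χ) (hB0 : ∀ φ χ, 0 ≤ biquadForm B φ χ)
    {φ : Fin m → ℂ} {χ : Fin n → ℂ} (hq : IsQuadraticZero A φ χ)
    (hB : biquadForm B φ χ = 0) :
    ∃ ε > 0, ∀ᶠ x : (Fin m → ℂ) × (Fin n → ℂ) in 𝓝 (φ, χ),
      ε * biquadForm B x.1 x.2 ≤ biquadForm A x.1 x.2 := by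
  obtain ⟨ε, hε, hev⟩ := eventually_taylorQuotient_le hA B hq
  refine ⟨ε, hε, ?_⟩
  have hφ : star φ ⬝ᵥ φ ≠ 0 := fun h => hq.1.1 (dotProduct_star_self_eq_zero.1 h)
  have hχ : star χ ⬝ᵥ χ ≠ 0 := fun h => hq.1.2.1 (dotProduct_star_self_eq_zero.1 h)
  -- Dividing by the component along `φ` (resp. `χ`) makes the displacement `r x` orthogonal in each
  -- factor.
  set a : (Fin m → ℂ) × (Fin n → ℂ) → ℂ := fun x => (star φ ⬝ᵥ x.1) / (star φ ⬝ᵥ φ) with ha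
  set b : (Fin m → ℂ) × (Fin n → ℂ) → ℂ := fun x => (star χ ⬝ᵥ x.2) / (star χ ⬝ᵥ χ) with hb
  have hac : Continuous a := (continuous_const.dotProduct continuous_fst).div_const _
  have hbc : Continuous b := (continuous_const.dotProduct continuous_snd).div_const _
  have ha1 : a (φ, χ) = 1 := by simp [ha, hφ]
  have hb1 : b (φ, χ) = 1 := by simp [hb, hχ]
  have hane : ∀ᶠ x in 𝓝 (φ, χ), a x ≠ 0 :=
    hac.continuousAt.eventually_ne (by rw [ha1]; exact one_ne_zero)
  have hbne : ∀ᶠ x in 𝓝 (φ, χ), b x ≠ 0 :=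
    hbc.continuousAt.eventually_ne (by rw [hb1]; exact one_ne_zero)
  set r : (Fin m → ℂ) × (Fin n → ℂ) → (Fin m → ℂ) × (Fin n → ℂ) :=
    fun x => ((a x)⁻¹ • x.1 - φ, (b x)⁻¹ • x.2 - χ) with hr
  have hrc : Tendsto (fun x => ‖r x‖) (𝓝 (φ, χ)) (𝓝 0) := by
    have h1 : ContinuousAt (fun x => ‖r x‖) (φ, χ) := by
      have h2 := hac.continuousAt (x := (φ, χ)).inv₀ (by rw [ha1]; exact one_ne_zero)
      have h3 := hbc.continuousAt (x := (φ, χ)).inv₀ (by rw [hb1]; exact one_ne_zero)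
      exact (((h2.smul continuousAt_fst).sub continuousAt_const).prodMk
        ((h3.smul continuousAt_snd).sub continuousAt_const)).norm
    have h4 : ‖r (φ, χ)‖ = 0 := by simp [hr, ha1, hb1]
    simpa [ContinuousAt, h4] using h1
  filter_upwards [hane, hbne, hrc.eventually hev] with x hax hbx hx
  have hx1 : x.1 = a x • (φ + (r x).1) := by simp [hr, smul_smul, hax]
  have hx2 : x.2 = b x • (χ + (r x).2) := by simp [hr, smul_smul, hbx]
  rw [hx1, hx2, biquadForm_smul_smul, biquadForm_smul_smul, mul_left_comm]
  refine mul_le_mul_of_nonneg_left ?_ (by positivity)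
  by_cases h0 : r x = 0
  · simp [h0, hB, hq.1.2.2]
  have hn : ‖r x‖ ≠ 0 := norm_ne_zero_iff.2 h0
  have hmem : (((‖r x‖⁻¹ : ℝ) : ℂ) • r x) ∈ unitTransverse φ χ := by
    refine ⟨?_, ?_, ?_⟩
    · simp [norm_smul, hn]
    · have : star φ ⬝ᵥ (r x).1 = 0 := by
        have h5 : star φ ⬝ᵥ x.1 = a x * (star φ ⬝ᵥ φ) := by simp [ha, hφ]
        simp [hr, dotProduct_sub, dotProduct_smul, h5, hax]
      simp [dotProduct_smul, this]
    · have : star χ ⬝ᵥ (r x).2 = 0 := by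
        have h5 : star χ ⬝ᵥ x.2 = b x * (star χ ⬝ᵥ χ) := by simp [hb, hχ]
        simp [hr, dotProduct_sub, dotProduct_smul, h5, hbx]
      simp [dotProduct_smul, this]
  -- Polar decomposition of the displacement: `t = ‖r x‖` times a unit transverse direction.
  have hfac : r x = ((‖r x‖ : ℝ) : ℂ) • (((‖r x‖⁻¹ : ℝ) : ℂ) • r x) := by
    rw [smul_smul, ← Complex.ofReal_mul, mul_inv_cancel₀ hn]; simp
  have key := hx _ hmem
  rw [hfac]
  generalize (((‖r x‖⁻¹ : ℝ) : ℂ) • r x) = y at key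
  rw [Prod.smul_fst, Prod.smul_snd, biquadForm_add_smul_of_zero hA0 hq.1.2.2,
    biquadForm_add_smul_of_zero hB0 hB, mul_left_comm]
  refine mul_le_mul_of_nonneg_left ?_ (by positivity)
  exact (mul_le_mul_of_nonneg_left (le_abs_self _) hε.le).trans key

/-- A nonnegative biquadratic form that vanishes at all zeros of a form with only quadratic
zeros is dominated by a multiple of the latter. -/
lemma exists_biquadForm_domination {A B : BipartiteMatrix m n} (hA : A.IsHermitian)
    (hA0 : ∀ φ χ, 0 ≤ biquadForm A φ χ) (hB0 : ∀ φ χ, 0 ≤ biquadForm B φ χ)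
    (hq : ∀ φ χ, IsZero A φ χ → IsQuadraticZero A φ χ)
    (hB : ∀ φ χ, IsZero A φ χ → biquadForm B φ χ = 0) :
    ∃ ε > 0, ∀ φ χ, ε * biquadForm B φ χ ≤ biquadForm A φ χ := by
  have hK : IsCompact (Metric.sphere (0 : Fin m → ℂ) 1 ×ˢ Metric.sphere (0 : Fin n → ℂ) 1) :=
    (isCompact_sphere _ _).prod (isCompact_sphere _ _)
  obtain ⟨ε, hε, h⟩ := hK.induction_on
    (p := fun s => ∃ ε > 0, ∀ x ∈ s, ε * biquadForm B x.1 x.2 ≤ biquadForm A x.1 x.2)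
    ⟨1, one_pos, by simp⟩
    (by
      rintro s s' hs ⟨ε, hε, h⟩
      exact ⟨ε, hε, fun x hx => h x (hs hx)⟩)
    (by
      rintro s s' ⟨ε, hε, h⟩ ⟨ε', hε', h'⟩
      refine ⟨min ε ε', lt_min hε hε', ?_⟩
      rintro x (hx | hx)
      · exact (mul_le_mul_of_nonneg_right (min_le_left _ _) (hB0 _ _)).trans (h x hx)
      · exact (mul_le_mul_of_nonneg_right (min_le_right _ _) (hB0 _ _)).trans (h' x hx))
    (by
      rintro ⟨φ, χ⟩ ⟨hφ, hχ⟩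
      have hφ0 : φ ≠ 0 := by rintro rfl; simp at hφ
      have hχ0 : χ ≠ 0 := by rintro rfl; simp at hχ
      suffices ∃ ε > 0, ∀ᶠ x : (Fin m → ℂ) × (Fin n → ℂ) in 𝓝 (φ, χ),
          ε * biquadForm B x.1 x.2 ≤ biquadForm A x.1 x.2 by
        obtain ⟨ε, hε, hev⟩ := this
        exact ⟨_, mem_nhdsWithin_of_mem_nhds hev, ε, hε, fun x hx => hx⟩
      by_cases hz : biquadForm A φ χ = 0
      · have hZ : IsZero A φ χ := ⟨hφ0, hχ0, hz⟩
        exact biquadForm_domination_near_zero hA hA0 hB0 (hq _ _ hZ) (hB _ _ hZ)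
      · have hpos : 0 < biquadForm A φ χ := lt_of_le_of_ne (hA0 _ _) (Ne.symm hz)
        have hBn := hB0 φ χ
        -- The `+ 1` avoids division by zero and makes the inequality at `(φ, χ)` strict, hence
        -- stable nearby.
        refine ⟨biquadForm A φ χ / (biquadForm B φ χ + 1), by positivity, ?_⟩
        refine ((((continuous_biquadForm B).const_mul _).tendsto (φ, χ)).eventually_lt
          ((continuous_biquadForm A).tendsto (φ, χ)) ?_).mono fun x hx => hx.le
        simp only
        rw [div_mul_eq_mul_div, div_lt_iff₀ (by positivity)]
        nlinarith)
  refine ⟨ε, hε, fun φ χ => ?_⟩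
  by_cases hφ : φ = 0
  · simp [hφ, biquadForm, sesq]
  by_cases hχ : χ = 0
  · simp [hχ, biquadForm, sesq]
  have hφn : ‖φ‖ ≠ 0 := norm_ne_zero_iff.2 hφ
  have hχn : ‖χ‖ ≠ 0 := norm_ne_zero_iff.2 hχ
  have key := h (((‖φ‖⁻¹ : ℝ) : ℂ) • φ, ((‖χ‖⁻¹ : ℝ) : ℂ) • χ)
    ⟨by simp [norm_smul, hφn], by simp [norm_smul, hχn]⟩
  simp only [biquadForm_smul_smul] at key
  rw [mul_left_comm] at key
  refine le_of_mul_le_mul_left key ?_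
  have := norm_pos_iff.2 hφ
  have := norm_pos_iff.2 hχ
  rw [Complex.norm_real, Complex.norm_real, norm_inv, norm_inv, norm_norm, norm_norm]
  positivity

/-- Domination keeps the form of `A - p B` nonnegative for small `p`; dividing by its trace `1 - p`
gives the other component. -/
lemma isProperMixtureWith_of_vanishing {A B : BipartiteMatrix m n}
    {C : BipartiteMatrix m n → Prop} (hA : IsQuadraticWitness A) (hBw : B ∈ witnesses m n)
    (hC : C B) (hne : B ≠ A) (hB : ∀ φ χ, IsZero A φ χ → biquadForm B φ χ = 0) :
    IsProperMixtureWith C A := by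
  obtain ⟨⟨hAh, hAt, hA0⟩, -, hq⟩ := hA
  obtain ⟨hBh, hBt, hB0⟩ := hBw
  obtain ⟨ε, hε, hdom⟩ := exists_biquadForm_domination hAh hA0 hB0 hq hB
  obtain ⟨p, hp0, hp1, hpε⟩ : ∃ p : ℝ, 0 < p ∧ p < 1 ∧ p ≤ ε :=
    ⟨min ε (1 / 2), by positivity, (min_le_right _ _).trans_lt (by norm_num), min_le_left _ _⟩
  have hp : (1 - p) ≠ 0 := by linarith
  have hcomb : A = (1 - p) • ((1 - p)⁻¹ • (A + (-p) • B)) + p • B := by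
    rw [smul_smul, mul_inv_cancel₀ hp, one_smul, neg_smul, neg_add_cancel_right]
  refine ⟨(1 - p)⁻¹ • (A + (-p) • B), ⟨?_, ?_, fun φ χ => ?_⟩, B, ⟨hBh, hBt, hB0⟩, ?_, hne, hC, p,
    hp0, hp1, hcomb⟩
  · have hsm : ∀ (c : ℝ) {M : BipartiteMatrix m n}, M.IsHermitian → (c • M).IsHermitian := by
      intro c M hM
      rw [Matrix.IsHermitian, Matrix.conjTranspose_smul, hM.eq, star_trivial]
    exact hsm _ (hAh.add (hsm _ hBh))
  · rw [Matrix.trace_smul, Matrix.trace_add, Matrix.trace_smul, hAt, hBt]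
    have : (1 : ℂ) + (-p) • (1 : ℂ) = (1 - p) • (1 : ℂ) := by
      rw [sub_smul, neg_smul, one_smul, sub_eq_add_neg]
    rw [this, smul_smul, inv_mul_cancel₀ hp, one_smul]
  · rw [biquadForm_real_smul, biquadForm_add, biquadForm_real_smul]
    have h1 := hdom φ χ
    have h2 := mul_le_mul_of_nonneg_right hpε (hB0 φ χ)
    have : 0 ≤ (1 - p)⁻¹ := inv_nonneg.2 (by linarith)
    exact mul_nonneg this (by linarith)
  · intro h
    rw [h, ← sub_eq_iff_eq_add'] at hcomb
    have h2 : p • A = p • B := by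
      rw [← hcomb, sub_smul, one_smul, sub_sub_cancel]
    exact hne (smul_right_injective _ hp0.ne' h2.symm)

end Domination

/-! ### Partial transposition as conjugation of the second factor -/

section PartialTranspose

variable {m n : ℕ}

lemma sesq_eq_sum (A : BipartiteMatrix m n) (u v : Fin m × Fin n → ℂ) :
    sesq A u v = ∑ i, ∑ j, ∑ k, ∑ l, star (u (i, j)) * A (i, j) (k, l) * v (k, l) := by
  simp [sesq, dotProduct, Matrix.mulVec, Fintype.sum_prod_type, Finset.mul_sum, mul_assoc]

lemma sesq_partialTranspose (A : BipartiteMatrix m n) (φ ξ : Fin m → ℂ) (χ ζ : Fin n → ℂ) :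
    sesq (partialTranspose A) (prodVec φ χ) (prodVec ξ ζ) =
      sesq A (prodVec φ (star ζ)) (prodVec ξ (star χ)) := by
  simp only [sesq_eq_sum, partialTranspose, prodVec, Matrix.of_apply]
  refine Finset.sum_congr rfl fun i _ => ?_
  calc _ = ∑ j, ∑ l, ∑ k, star (φ i * χ j) * A (i, l) (k, j) * (ξ k * ζ l) :=
        Finset.sum_congr rfl fun j _ => Finset.sum_comm
    _ = ∑ l, ∑ k, ∑ j, star (φ i * χ j) * A (i, l) (k, j) * (ξ k * ζ l) := by
        rw [Finset.sum_comm]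
        exact Finset.sum_congr rfl fun l _ => Finset.sum_comm
    _ = _ := by
        refine Finset.sum_congr rfl fun l _ => Finset.sum_congr rfl fun k _ =>
          Finset.sum_congr rfl fun j _ => ?_
        simp
        ring

lemma biquadForm_partialTranspose (A : BipartiteMatrix m n) (φ : Fin m → ℂ) (χ : Fin n → ℂ) :
    biquadForm (partialTranspose A) φ χ = biquadForm A φ (star χ) := by
  rw [biquadForm, sesq_partialTranspose, biquadForm]

lemma hessianForm_partialTranspose (A : BipartiteMatrix m n) (φ ξ : Fin m → ℂ)
    (χ ζ : Fin n → ℂ) :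
    hessianForm (partialTranspose A) φ χ ξ ζ = hessianForm A φ (star χ) ξ (star ζ) := by
  simp only [hessianForm, sesq_partialTranspose]
  rw [add_comm (sesq A (prodVec φ (star χ)) (prodVec ξ (star ζ)))]

lemma isHermitian_partialTranspose {A : BipartiteMatrix m n} (hA : A.IsHermitian) :
    (partialTranspose A).IsHermitian := by
  ext I J
  simpa [partialTranspose] using hA.apply (I.1, J.2) (J.1, I.2)

lemma trace_partialTranspose (A : BipartiteMatrix m n) :
    (partialTranspose A).trace = A.trace := by
  simp [partialTranspose, Matrix.trace]

lemma partialTranspose_zero : partialTranspose (0 : BipartiteMatrix m n) = 0 := by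
  ext I J; simp [partialTranspose]

end PartialTranspose

/-! ### Rank-one projections and their degenerate zeros -/

section RankOne

variable {m n : ℕ}

lemma sesq_vecMulVec (ψ u v : Fin m × Fin n → ℂ) :
    sesq (Matrix.vecMulVec ψ (star ψ)) u v = star (star ψ ⬝ᵥ u) * (star ψ ⬝ᵥ v) := by
  have h : star (star ψ ⬝ᵥ u) = star u ⬝ᵥ ψ := by
    rw [← Matrix.star_dotProduct]
  rw [sesq, Matrix.vecMulVec_mulVec, h, dotProduct_smul]
  simp

lemma biquadForm_vecMulVec (ψ : Fin m × Fin n → ℂ) (φ : Fin m → ℂ) (χ : Fin n → ℂ) :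
    biquadForm (Matrix.vecMulVec ψ (star ψ)) φ χ = ‖star ψ ⬝ᵥ prodVec φ χ‖ ^ 2 := by
  rw [biquadForm, sesq_vecMulVec, Complex.star_def, Complex.conj_mul']
  norm_cast

lemma exists_ne_zero_of_linearMap_eq_zero {k : ℕ} (hk : 2 ≤ k) (f : (Fin k → ℂ) →ₗ[ℂ] ℂ) :
    ∃ v, v ≠ 0 ∧ f v = 0 := by
  have : ¬ Function.Injective f := fun hf => by
    have := LinearMap.finrank_le_finrank_of_injective hf
    simp at this
    omega
  rw [← LinearMap.ker_eq_bot, Submodule.eq_bot_iff] at this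
  push Not at this
  obtain ⟨v, hv, hv0⟩ := this
  exact ⟨v, hv0, hv⟩

/-- The biquadratic form of a rank-one projection has a zero with degenerate Hessian. -/
lemma exists_degenerate_zero_vecMulVec (hm : 2 ≤ m) (hn : 2 ≤ n) (ψ : Fin m × Fin n → ℂ) :
    ∃ φ χ ξ ζ, IsZero (Matrix.vecMulVec ψ (star ψ)) φ χ ∧ star φ ⬝ᵥ ξ = 0 ∧ star χ ⬝ᵥ ζ = 0 ∧
      (ξ ≠ 0 ∨ ζ ≠ 0) ∧ hessianForm (Matrix.vecMulVec ψ (star ψ)) φ χ ξ ζ = 0 := by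
  obtain ⟨φ, hφ, -⟩ := exists_ne_zero_of_linearMap_eq_zero hm 0
  obtain ⟨χ, hχ, hψ⟩ := exists_ne_zero_of_linearMap_eq_zero hn
    { toFun := fun χ => star ψ ⬝ᵥ prodVec φ χ
      map_add' := fun x y => by rw [prodVec_add_right, dotProduct_add]
      map_smul' := fun c x => by simp [prodVec_smul_right, dotProduct_smul] }
  replace hψ : star ψ ⬝ᵥ prodVec φ χ = 0 := hψ
  obtain ⟨ξ, hξ, hφξ⟩ := exists_ne_zero_of_linearMap_eq_zero hm
    { toFun := fun ξ => star φ ⬝ᵥ ξ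
      map_add' := fun x y => dotProduct_add _ _ _
      map_smul' := fun c x => dotProduct_smul _ _ _ }
  obtain ⟨ζ, hζ, hχζ⟩ := exists_ne_zero_of_linearMap_eq_zero hn
    { toFun := fun ζ => star χ ⬝ᵥ ζ
      map_add' := fun x y => dotProduct_add _ _ _
      map_smul' := fun c x => dotProduct_smul _ _ _ }
  replace hφξ : star φ ⬝ᵥ ξ = 0 := hφξ
  replace hχζ : star χ ⬝ᵥ ζ = 0 := hχζ
  have hz : IsZero (Matrix.vecMulVec ψ (star ψ)) φ χ :=
    ⟨hφ, hχ, by simp [biquadForm_vecMulVec, hψ]⟩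
  -- Since `ψ ⊥ φ ⊗ χ`, the Hessian is the squared modulus of `⟨ψ, ξ ⊗ χ + φ ⊗ ζ⟩`.
  have hess : ∀ ξ ζ, star ψ ⬝ᵥ prodVec ξ χ = -(star ψ ⬝ᵥ prodVec φ ζ) →
      hessianForm (Matrix.vecMulVec ψ (star ψ)) φ χ ξ ζ = 0 := by
    intro ξ ζ h
    simp only [hessianForm, sesq_vecMulVec, h, hψ, star_neg, star_zero, zero_mul, add_zero]
    simp only [neg_mul, mul_neg, neg_neg, Complex.neg_re]
    ring
  -- One complex linear equation on a two-parameter family of transverse directions has a nonzero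
  -- solution.
  by_cases hα : star ψ ⬝ᵥ prodVec ξ χ = 0
  · exact ⟨φ, χ, ξ, 0, hz, hφξ, by simp, Or.inl hξ, hess _ _ (by simp [hα])⟩
  · refine ⟨φ, χ, (star ψ ⬝ᵥ prodVec φ ζ) • ξ, (-(star ψ ⬝ᵥ prodVec ξ χ)) • ζ, hz, ?_, ?_,
      Or.inr (smul_ne_zero (neg_ne_zero.2 hα) hζ), hess _ _ ?_⟩
    · simp [dotProduct_smul, hφξ]
    · simp [dotProduct_smul, hχζ]
    · simp only [prodVec_smul_left, prodVec_smul_right, dotProduct_smul, smul_eq_mul]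
      ring

lemma vecMulVec_ne_of_isQuadraticWitness (hm : 2 ≤ m) (hn : 2 ≤ n) {A : BipartiteMatrix m n}
    (hA : IsQuadraticWitness A) (ψ : Fin m × Fin n → ℂ) :
    Matrix.vecMulVec ψ (star ψ) ≠ A := by
  rintro rfl
  obtain ⟨φ, χ, ξ, ζ, hz, h1, h2, h3, h4⟩ := exists_degenerate_zero_vecMulVec hm hn ψ
  exact ((hA.2.2 φ χ hz).2 ξ ζ h1 h2 h3).ne' h4

/-- Conjugating the second factor carries the degenerate zero and its flat direction over to the
partial transpose. -/
lemma partialTranspose_vecMulVec_ne_of_isQuadraticWitness (hm : 2 ≤ m) (hn : 2 ≤ n)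
    {A : BipartiteMatrix m n} (hA : IsQuadraticWitness A) (ψ : Fin m × Fin n → ℂ) :
    partialTranspose (Matrix.vecMulVec ψ (star ψ)) ≠ A := by
  rintro rfl
  obtain ⟨φ, χ, ξ, ζ, ⟨hφ, hχ, hz⟩, h1, h2, h3, h4⟩ := exists_degenerate_zero_vecMulVec hm hn ψ
  refine ((hA.2.2 φ (star χ) ⟨hφ, star_ne_zero.2 hχ, ?_⟩).2 ξ (star ζ) h1 ?_
    (h3.imp_right star_ne_zero.2)).ne' ?_
  · rw [biquadForm_partialTranspose, star_star, hz]
  · rw [Matrix.star_dotProduct_star, dotProduct_comm, h2, star_zero]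
  · rw [hessianForm_partialTranspose, star_star, star_star, h4]

lemma exists_unit_orthogonal_of_ne_top {S : Submodule ℂ (Fin m × Fin n → ℂ)} (hS : S ≠ ⊤) :
    ∃ ψ : Fin m × Fin n → ℂ, star ψ ⬝ᵥ ψ = 1 ∧ ∀ v ∈ S, star ψ ⬝ᵥ v = 0 := by
  obtain ⟨f, hf, hSf⟩ := S.exists_le_ker_of_lt_top hS.lt_top
  have hrep : ∀ v, f v = star (fun I => star (f (Pi.single I 1))) ⬝ᵥ v := by
    intro v
    conv_lhs => rw [LinearMap.pi_apply_eq_sum_univ f v]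
    simp only [dotProduct, Pi.star_apply, star_star, smul_eq_mul]
    refine Finset.sum_congr rfl fun I _ => ?_
    rw [mul_comm]
    congr 2
    ext J
    simp [Pi.single_apply, eq_comm]
  generalize (fun I => star (f (Pi.single I 1))) = w at hrep
  have hw : w ≠ 0 := by
    rintro rfl
    exact hf (LinearMap.ext fun v => by simp [hrep])
  have hnn : 0 < star w ⬝ᵥ w := Matrix.dotProduct_star_self_pos_iff.2 hw
  obtain ⟨s, hs⟩ : ∃ s : ℝ, star w ⬝ᵥ w = s := ⟨_, (Complex.eq_re_of_ofReal_le hnn.le)⟩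
  rw [hs] at hnn
  have hs0 : 0 < s := by exact_mod_cast hnn
  refine ⟨(((Real.sqrt s)⁻¹ : ℝ) : ℂ) • w, ?_, fun v hv => ?_⟩
  · rw [star_smul, smul_dotProduct, dotProduct_smul, hs]
    simp only [Complex.star_def, Complex.conj_ofReal, smul_eq_mul]
    norm_cast
    rw [← mul_assoc, ← mul_inv, Real.mul_self_sqrt hs0.le, inv_mul_cancel₀ hs0.ne']
  · rw [star_smul, smul_dotProduct, ← hrep, LinearMap.mem_ker.1 (hSf hv), smul_zero]

lemma vecMulVec_mem_witnesses {ψ : Fin m × Fin n → ℂ} (hψ : star ψ ⬝ᵥ ψ = 1) :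
    Matrix.vecMulVec ψ (star ψ) ∈ witnesses m n := by
  refine ⟨(Matrix.posSemidef_vecMulVec_self_star ψ).1, ?_, fun φ χ => ?_⟩
  · rw [Matrix.trace_vecMulVec, dotProduct_comm, hψ]
  · rw [biquadForm_vecMulVec]; positivity

lemma partialTranspose_mem_witnesses {A : BipartiteMatrix m n} (hA : A ∈ witnesses m n) :
    partialTranspose A ∈ witnesses m n :=
  ⟨isHermitian_partialTranspose hA.1, (trace_partialTranspose A).trans hA.2.1,
    fun φ χ => (hA.2.2 φ (star χ)).trans_eq (biquadForm_partialTranspose A φ χ).symm⟩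

end RankOne

/-! ### Positive semidefinite and decomposable components -/

section Positive

variable {m n : ℕ}

lemma biquadForm_nonneg_of_posSemidef {A : BipartiteMatrix m n} (hA : A.PosSemidef)
    (φ : Fin m → ℂ) (χ : Fin n → ℂ) : 0 ≤ biquadForm A φ χ :=
  hA.re_dotProduct_nonneg _

lemma mulVec_prodVec_eq_zero_of_posSemidef {A : BipartiteMatrix m n} (hA : A.PosSemidef)
    {φ : Fin m → ℂ} {χ : Fin n → ℂ} (h : biquadForm A φ χ = 0) : A *ᵥ prodVec φ χ = 0 := by
  rw [← hA.dotProduct_mulVec_zero_iff]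
  exact Complex.ext h (Complex.le_def.1 (hA.dotProduct_mulVec_nonneg _)).2.symm

lemma eq_zero_of_mulVec_eq_zero_of_span_eq_top {A : BipartiteMatrix m n}
    {S : Set (Fin m × Fin n → ℂ)} (hS : Submodule.span ℂ S = ⊤) (h : ∀ v ∈ S, A *ᵥ v = 0) :
    A = 0 := by
  have hle : Submodule.span ℂ S ≤ LinearMap.ker A.mulVecLin :=
    Submodule.span_le.2 fun v hv => by simpa using h v hv
  rw [hS, top_le_iff, LinearMap.ker_eq_top] at hle
  exact (LinearEquiv.map_eq_zero_iff Matrix.toLin').1 hle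

lemma eq_zero_of_posSemidef_of_zeroSpan_eq_top {A B : BipartiteMatrix m n}
    (hA : zeroSpan A = ⊤) (hB : B.PosSemidef)
    (h : ∀ φ χ, IsZero A φ χ → biquadForm B φ χ = 0) : B = 0 := by
  refine eq_zero_of_mulVec_eq_zero_of_span_eq_top hA ?_
  rintro _ ⟨φ, χ, hz, rfl⟩
  exact mulVec_prodVec_eq_zero_of_posSemidef hB (h φ χ hz)

lemma eq_zero_of_posSemidef_of_partialConjZeroSpan_eq_top {A B : BipartiteMatrix m n}
    (hA : partialConjZeroSpan A = ⊤) (hB : B.PosSemidef)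
    (h : ∀ φ χ, IsZero A φ χ → biquadForm B φ (star χ) = 0) : B = 0 := by
  refine eq_zero_of_mulVec_eq_zero_of_span_eq_top hA ?_
  rintro _ ⟨φ, χ, hz, rfl⟩
  exact mulVec_prodVec_eq_zero_of_posSemidef hB (h φ χ hz)

/-- A decomposable matrix whose form vanishes at the zeros of `A` is zero, if these satisfy both
spanning conditions. -/
lemma eq_zero_of_isDecomposable {A B : BipartiteMatrix m n} (h1 : zeroSpan A = ⊤)
    (h2 : partialConjZeroSpan A = ⊤) (hB : IsDecomposable B)
    (h : ∀ φ χ, IsZero A φ χ → biquadForm B φ χ = 0) : B = 0 := by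
  obtain ⟨ρ, σ, hρ, hσ, rfl⟩ := hB
  have key : ∀ φ χ, IsZero A φ χ → biquadForm ρ φ χ = 0 ∧ biquadForm σ φ (star χ) = 0 := by
    intro φ χ hz
    have := h φ χ hz
    rw [biquadForm_add, biquadForm_partialTranspose] at this
    exact (add_eq_zero_iff_of_nonneg (biquadForm_nonneg_of_posSemidef hρ _ _)
      (biquadForm_nonneg_of_posSemidef hσ _ _)).1 this
  rw [eq_zero_of_posSemidef_of_zeroSpan_eq_top h1 hρ fun φ χ hz => (key φ χ hz).1,
    eq_zero_of_posSemidef_of_partialConjZeroSpan_eq_top h2 hσ fun φ χ hz => (key φ χ hz).2,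
    partialTranspose_zero, add_zero]

lemma witness_ne_zero {A : BipartiteMatrix m n} (hA : A ∈ witnesses m n) : A ≠ 0 := by
  rintro rfl
  simpa using hA.2.1

/-- At a zero of the mixture both nonnegative terms vanish, so `A₁` would satisfy `hC` and be zero,
against trace one. -/
lemma not_isProperMixtureWith {A : BipartiteMatrix m n} {C : BipartiteMatrix m n → Prop}
    (hC : ∀ B, C B → (∀ φ χ, IsZero A φ χ → biquadForm B φ χ = 0) → B = 0) :
    ¬ IsProperMixtureWith C A := by
  rintro ⟨A₀, hA₀, A₁, hA₁, -, -, hC₁, p, hp0, hp1, hcomb⟩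
  refine witness_ne_zero hA₁ (hC A₁ hC₁ fun φ χ hz => ?_)
  have h := hz.2.2
  rw [hcomb, biquadForm_add, biquadForm_real_smul, biquadForm_real_smul,
    add_eq_zero_iff_of_nonneg (mul_nonneg (by linarith) (hA₀.2.2 _ _))
      (mul_nonneg hp0.le (hA₁.2.2 _ _))] at h
  exact (mul_eq_zero.1 h.2).resolve_left hp0.ne'

lemma _root_.Matrix.PosSemidef.isDecomposable {A : BipartiteMatrix m n} (hA : A.PosSemidef) :
    IsDecomposable A :=
  ⟨A, 0, hA, Matrix.PosSemidef.zero, by rw [partialTranspose_zero, add_zero]⟩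

lemma IsNondecomposableOptimal.isOptimal {A : BipartiteMatrix m n}
    (hA : IsNondecomposableOptimal A) : IsOptimal A :=
  ⟨hA.1, fun ⟨A₀, h₀, A₁, h₁, hne₀, hne₁, hC, hp⟩ =>
    hA.2 ⟨A₀, h₀, A₁, h₁, hne₀, hne₁, hC.isDecomposable, hp⟩⟩

lemma zeroSpan_eq_top_of_isOptimal (hm : 2 ≤ m) (hn : 2 ≤ n) {A : BipartiteMatrix m n}
    (hA : IsQuadraticWitness A) (hopt : IsOptimal A) : zeroSpan A = ⊤ := by
  by_contra hS
  obtain ⟨ψ, hψ, hort⟩ := exists_unit_orthogonal_of_ne_top hS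
  refine hopt.2 (isProperMixtureWith_of_vanishing hA (vecMulVec_mem_witnesses hψ)
    (Matrix.posSemidef_vecMulVec_self_star ψ) (vecMulVec_ne_of_isQuadraticWitness hm hn hA ψ)
    fun φ χ hz => ?_)
  rw [biquadForm_vecMulVec, hort _ (Submodule.subset_span ⟨φ, χ, hz, rfl⟩)]
  simp

lemma partialConjZeroSpan_eq_top_of_isNondecomposableOptimal (hm : 2 ≤ m) (hn : 2 ≤ n)
    {A : BipartiteMatrix m n} (hA : IsQuadraticWitness A) (hopt : IsNondecomposableOptimal A) :
    partialConjZeroSpan A = ⊤ := by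
  by_contra hS
  obtain ⟨ψ, hψ, hort⟩ := exists_unit_orthogonal_of_ne_top hS
  refine hopt.2 (isProperMixtureWith_of_vanishing hA
    (partialTranspose_mem_witnesses (vecMulVec_mem_witnesses hψ))
    ⟨0, _, Matrix.PosSemidef.zero, Matrix.posSemidef_vecMulVec_self_star ψ, (zero_add _).symm⟩
    (partialTranspose_vecMulVec_ne_of_isQuadraticWitness hm hn hA ψ) fun φ χ hz => ?_)
  rw [biquadForm_partialTranspose, biquadForm_vecMulVec,
    hort _ (Submodule.subset_span ⟨φ, χ, hz, rfl⟩)]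
  simp

end Positive

end EntanglementWitness

open EntanglementWitness in
theorem mainTheorem7 (Na Nb : ℕ) (hNa : 2 ≤ Na) (hNb : 2 ≤ Nb)
    (Ω : EntanglementWitness.BipartiteMatrix Na Nb)
    (hΩ : EntanglementWitness.IsQuadraticWitness Ω) :
    (EntanglementWitness.IsOptimal Ω ↔ EntanglementWitness.zeroSpan Ω = ⊤) ∧
    (EntanglementWitness.IsNondecomposableOptimal Ω ↔
      EntanglementWitness.zeroSpan Ω = ⊤ ∧ EntanglementWitness.partialConjZeroSpan Ω = ⊤) ∧
    (EntanglementWitness.IsNondecomposableOptimal Ω →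
      ¬ EntanglementWitness.IsDecomposable Ω) := by
  have hspan : IsNondecomposableOptimal Ω → zeroSpan Ω = ⊤ ∧ partialConjZeroSpan Ω = ⊤ :=
    fun h => ⟨zeroSpan_eq_top_of_isOptimal hNa hNb hΩ h.isOptimal,
      partialConjZeroSpan_eq_top_of_isNondecomposableOptimal hNa hNb hΩ h⟩
  refine ⟨⟨zeroSpan_eq_top_of_isOptimal hNa hNb hΩ, fun h => ⟨hΩ.1, ?_⟩⟩,
    ⟨hspan, fun h => ⟨hΩ.1, ?_⟩⟩, fun h hdec => ?_⟩
  · exact not_isProperMixtureWith fun B hB => eq_zero_of_posSemidef_of_zeroSpan_eq_top h hB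
  · exact not_isProperMixtureWith fun B hB => eq_zero_of_isDecomposable h.1 h.2 hB
  · exact witness_ne_zero hΩ.1 (eq_zero_of_isDecomposable (hspan h).1 (hspan h).2 hdec
      fun φ χ hz => hz.2.2)
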